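/- Let $\Bbbk$ be an algebraically closed field of characteristic zero. In the hyperplane $\mathbb{P}^4=\{x_1+\dots+x_6=0\}\subset\mathbb{P}^5$ over $\Bbbk$, the Cremona–Richmond configuration $\mathrm{CR}$ consists of the 15 lines $\{x_i=x_j \text{ whenever } \{i,j\}\in\{I_1,I_2,I_3\}\}$, one for each splitting $\{1,\dots,6\}=I_1\sqcup I_2\sqcup I_3$ into three pairs, together with their 15 intersection points; the Igusa quartic is the quartic threefold in this $\mathbb{P}^4$ given by $$\sum_{i=1}^6 x_i^4-\frac14\Big(\sum_{i=1}^6 x_i^2\Big)^2=0 .$$ Let $\mathrm{C}$ be a configuration of 15 distinct lines in $\mathbb{P}^4$ with exactly 15 intersection points (points lying on at least two of the lines), which is not contained in a hyperplane $\mathbb{P}^3\subset\mathbb{P}^4$ and is combinatorially isomorphic to $\mathrm{CR}$; that is, there are a bijection between the lines of $\mathrm{C}$ and those of $\mathrm{CR}$ and a bijection between their intersection points such that a point lies on a line if and only if the corresponding point lies on the corresponding line. Let $X\subset\mathbb{P}^4$ be a quartic threefold (the hypersurface defined by a nonzero quartic form) whose singular locus contains every line of $\mathrm{C}$. Then $X$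 is projectively isomorphic to the Igusa quartic: some projective linear isomorphism between the two ambient $\mathbb{P}^4$'s maps $X$ onto the Igusa quartic, as hypersurfaces (equivalently, it identifies their defining forms up to a nonzero scalar). -/

import Mathlib

open MvPolynomial
open scoped LinearAlgebra.Projectivization

noncomputable section

namespace CremonaRichmond

variable {k : Type*} [Field k]

/-- The set of points of the projective space `ℙ k V` lying on the projective subspace given by a
linear subspace `L` of `V`. A line of `ℙ k V` is given by an `L` with `finrank k L = 2`, a
hyperplane of `ℙ⁴` by an `L` with `finrank k L = 4`. -/
def pointSet {V : Type*} [AddCommGroup V] [Module k V] (L : Submodule k V) : Set (ℙ k V) :=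
  {p | p.submodule ≤ L}

/-- The intersection points of a set of lines: the points lying on two different lines. -/
def intersectionPoints {V : Type*} [AddCommGroup V] [Module k V] (S : Set (Submodule k V)) :
    Set (ℙ k V) :=
  {p | ∃ L ∈ S, ∃ M ∈ S, L ≠ M ∧ p ∈ pointSet L ∧ p ∈ pointSet M}

/-- A configuration of 15 (distinct) lines with 15 intersection points. -/
structure IsConfiguration {V : Type*} [AddCommGroup V] [Module k V] (S : Set (Submodule k V)) :
    Prop where
  isLine : ∀ L ∈ S, Module.finrank k L = 2
  card_lines : S.ncard = 15
  card_points : (intersectionPoints S).ncard = 15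

/-- Two line configurations (possibly in different projective spaces) are combinatorially
isomorphic: there are a bijection of their lines and a bijection of their intersection points
under which incidence corresponds. -/
def CombIso {V W : Type*} [AddCommGroup V] [Module k V] [AddCommGroup W] [Module k W]
    (S : Set (Submodule k V)) (T : Set (Submodule k W)) : Prop :=
  ∃ (f : S ≃ T) (g : intersectionPoints S ≃ intersectionPoints T),
    ∀ (L : S) (p : intersectionPoints S),
      (p : ℙ k V) ∈ pointSet (L : Submodule k V) ↔
        (g p : ℙ k W) ∈ pointSet (f L : Submodule k W)

variable (k)

/-- The hyperplane `x₁ + ⋯ + x₆ = 0` of `k⁶`; its projectivization is the `ℙ⁴` containing the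
Cremona–Richmond configuration and the Igusa quartic. -/
def sumZero : Submodule k (Fin 6 → k) where
  carrier := {x | ∑ i, x i = 0}
  zero_mem' := by simp
  add_mem' := by
    intro x y hx hy
    change ∑ i, x i = 0 at hx
    change ∑ i, y i = 0 at hy
    change ∑ i, (x + y) i = 0
    simp [Finset.sum_add_distrib, hx, hy]
  smul_mem' := by
    intro c x hx
    change ∑ i, x i = 0 at hx
    change ∑ i, (c • x) i = 0
    simp [← Finset.mul_sum, hx]

/-- The subspace of `sumZero k` of vectors whose coordinates are constant on each of the
sets `I₁`, `I₂`, `I₃`. -/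
def splittingLine (I₁ I₂ I₃ : Finset (Fin 6)) : Submodule k (sumZero k) where
  carrier := {x | ∀ i j, (i ∈ I₁ ∧ j ∈ I₁) ∨ (i ∈ I₂ ∧ j ∈ I₂) ∨ (i ∈ I₃ ∧ j ∈ I₃) →
    (x : Fin 6 → k) i = (x : Fin 6 → k) j}
  zero_mem' := by intro i j _; rfl
  add_mem' := by
    intro x y hx hy i j h
    simp [hx i j h, hy i j h]
  smul_mem' := by
    intro c x hx i j h
    simp [hx i j h]

/-- The Cremona–Richmond configuration: the lines given by the 15 splittings of the six indices
into three (unordered) pairs. -/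
def crLines : Set (Submodule k (sumZero k)) :=
  {L | ∃ I₁ I₂ I₃ : Finset (Fin 6), I₁.card = 2 ∧ I₂.card = 2 ∧ I₃.card = 2 ∧
    Disjoint I₁ I₂ ∧ Disjoint I₁ I₃ ∧ Disjoint I₂ I₃ ∧ I₁ ∪ I₂ ∪ I₃ = Finset.univ ∧
    L = splittingLine k I₁ I₂ I₃}

/-- The form cutting out the Igusa quartic in the hyperplane `x₁ + ⋯ + x₆ = 0`. -/
def igusaForm : MvPolynomial (Fin 6) k :=
  (∑ i, X i ^ 4) - C (1 / 4 : k) * (∑ i, X i ^ 2) ^ 2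

variable {k}

/-- The singular locus of the hypersurface `F = 0` of `ℙ⁴`, for `F` homogeneous: the points
where `F` and all its partial derivatives vanish. -/
def singularLocus (F : MvPolynomial (Fin 5) k) : Set (ℙ k (Fin 5 → k)) :=
  {p | ∀ v ∈ p.submodule, eval v F = 0 ∧ ∀ i, eval v (pderiv i F) = 0}

/-- The pullback of a polynomial along a linear map, i.e. the linear substitution. -/
def pullback {m n : ℕ} (φ : (Fin m → k) →ₗ[k] (Fin n → k)) (G : MvPolynomial (Fin n) k) :
    MvPolynomial (Fin m) k :=
  aeval (fun i : Fin n => ∑ j : Fin m, C (φ (Pi.single j 1) i) * X j) G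

theorem eval_pullback {m n : ℕ} (φ : (Fin m → k) →ₗ[k] (Fin n → k))
    (G : MvPolynomial (Fin n) k) (v : Fin m → k) :
    eval v (pullback φ G) = eval (φ v) G := by
  have h : φ v = fun i => ∑ j, φ (Pi.single j 1) i * v j := by
    funext i
    rw [LinearMap.pi_apply_eq_sum_univ φ v, Finset.sum_apply]
    refine Finset.sum_congr rfl fun j _ => ?_
    have e : (fun l => if j = l then (1 : k) else 0) = Pi.single j 1 := by
      funext l
      simp [Pi.single_apply, eq_comm]
    simp [e, mul_comm]
  rw [h, pullback]
  induction G using MvPolynomial.induction_on with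
  | C a => simp
  | add p q hp hq => simp only [map_add, hp, hq]
  | mul_X p i hp =>
    rw [map_mul, map_mul, map_mul, hp]
    simp

/-- The hypersurface `F = 0` of `ℙ⁴` is projectively isomorphic to the Igusa quartic: some linear
isomorphism from `k⁵` onto the hyperplane `x₁ + ⋯ + x₆ = 0` pulls the Igusa form back to a nonzero
multiple of `F`, i.e. the induced projective isomorphism identifies the two hypersurfaces
as schemes. -/
def ProjIsoIgusa (F : MvPolynomial (Fin 5) k) : Prop :=
  ∃ (φ : (Fin 5 → k) ≃ₗ[k] sumZero k) (c : k), c ≠ 0 ∧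
    pullback ((sumZero k).subtype ∘ₗ φ.toLinearMap) (igusaForm k) = C c * F

end CremonaRichmond

end

/-!
A configuration combinatorially isomorphic to the Cremona–Richmond configuration has 15 points
labelled by the pairs in `{0, …, 5}`, and 15 lines labelled by the splittings into three pairs; the
points on a line are those of the pairs of its splitting. The proof has two halves.

*Rigidity.* If the points span `ℙ⁴`, representatives can be scaled so that the three vectors on
each line add up to zero (`exists_linearEquiv`). The nine pairs `ij` with `i ≤ 2 < j` form a
`3 × 3` grid of collinear triples, whose points are generated by four of them;
`exists_grid_scaling` scales these nine. The six remaining points lie on nine lines, each with one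
grid point, and `exists_bipartite_scaling` scales them. In both cases the relations of a spanning
tree of incidences can be prescribed, and linear independence of the generating points forces the
remaining coefficients. The sum-zero relations express all points through the basis `0j`, in the
same way as for the standard configuration, so that a linear isomorphism carries the standard
configuration to the given one.

*Uniqueness of the quartic.* Consider the polarization of a quartic form `H` singular along all
lines, in the basis `e j` of the points `0j`, where the point `lm` is `e l + e m - ½ ∑ x, e x`.
Singularity along the line `⟨p, q⟩` says that the polarization vanishes at `(p, p, q, w)` for all
`w`. With `p = 0j`, `q = lm` and the other way round, this determines the whole tensor from its
entry at `(0, 0, 1, 1)` (`tensor_eq_zero`), so such forms are unique up to a scalar. Both `F` and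
the pullback of the Igusa form are of this kind and nonzero; for the latter, the gradient of the
Igusa form is proportional to `(1, …, 1)` along the lines (`eval_dirDeriv_igusaForm_eq_zero`).
-/

noncomputable section

namespace CremonaRichmond

/-! ### Directional derivatives and polarization of quartic forms -/

section Polarization

variable {k : Type*} [Field k] {m n : ℕ}

/-- The derivative of polynomials in the direction of a vector, linear in that vector. -/
def dirDeriv : (Fin n → k) →ₗ[k] Module.End k (MvPolynomial (Fin n) k) where
  toFun v := ∑ i, v i • (pderiv i : Derivation k (MvPolynomial (Fin n) k) _).toLinearMap
  map_add' v w := by simp [add_smul, Finset.sum_add_distrib]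
  map_smul' c v := by simp [mul_smul, Finset.smul_sum]

theorem dirDeriv_apply (v : Fin n → k) (p : MvPolynomial (Fin n) k) :
    dirDeriv v p = ∑ i, v i • pderiv i p := by
  simp [dirDeriv, LinearMap.sum_apply]

theorem dirDeriv_mul (v : Fin n → k) (p q : MvPolynomial (Fin n) k) :
    dirDeriv v (p * q) = p * dirDeriv v q + q * dirDeriv v p := by
  simp only [dirDeriv_apply, Derivation.leibniz, smul_eq_mul, Finset.mul_sum, smul_add,
    Finset.sum_add_distrib, mul_smul_comm]

theorem dirDeriv_C (v : Fin n → k) (c : k) : dirDeriv v (C c) = 0 := by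
  simp [dirDeriv_apply]

theorem dirDeriv_X (v : Fin n → k) (i : Fin n) : dirDeriv v (X i) = C (v i) := by
  simp [dirDeriv_apply, pderiv_X, Pi.single_apply, smul_eq_C_mul]

theorem dirDeriv_comm (v w : Fin n → k) (p : MvPolynomial (Fin n) k) :
    dirDeriv v (dirDeriv w p) = dirDeriv w (dirDeriv v p) := by
  induction p using MvPolynomial.induction_on with
  | C a => simp [dirDeriv_C]
  | add p q hp hq => simp only [map_add, hp, hq]
  | mul_X p i hp =>
    simp only [dirDeriv_mul, dirDeriv_X, dirDeriv_C, map_add, hp]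
    ring

theorem isHomogeneous_dirDeriv {d : ℕ} {p : MvPolynomial (Fin n) k}
    (hp : p.IsHomogeneous (d + 1)) (v : Fin n → k) : (dirDeriv v p).IsHomogeneous d := by
  rw [dirDeriv_apply]
  refine IsHomogeneous.sum _ _ _ fun i _ => ?_
  rw [smul_eq_C_mul]
  exact hp.pderiv.C_mul _

/-- Euler's identity at a point. -/
theorem eval_dirDeriv_self {d : ℕ} {p : MvPolynomial (Fin n) k} (hp : p.IsHomogeneous d)
    (v : Fin n → k) : eval v (dirDeriv v p) = d * eval v p := by
  have h := congrArg (eval v) hp.sum_X_mul_pderiv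
  simpa [dirDeriv_apply, smul_eval] using h

theorem dirDeriv_pullback (φ : (Fin m → k) →ₗ[k] (Fin n → k)) (G : MvPolynomial (Fin n) k)
    (w : Fin m → k) : dirDeriv w (pullback φ G) = pullback φ (dirDeriv (φ w) G) := by
  have h (i : Fin n) : φ w i = ∑ j, φ (Pi.single j 1) i * w j := by
    have := eval_pullback φ (X i) w
    simpa [pullback] using this.symm
  induction G using MvPolynomial.induction_on with
  | C a => simp [dirDeriv_C, pullback, algebraMap_eq]
  | add p q hp hq => simp only [pullback, map_add] at hp hq ⊢; rw [hp, hq]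
  | mul_X p i hp =>
    have hX : dirDeriv w (pullback φ (X i)) = C (φ w i) := by
      rw [h]
      simp [pullback, dirDeriv_mul, dirDeriv_X, dirDeriv_C, map_sum]
    have hC : pullback φ (C (φ w i)) = C (φ w i) := by simp [pullback, algebraMap_eq]
    have hm (p q : MvPolynomial (Fin n) k) : pullback φ (p * q) = pullback φ p * pullback φ q := by
      simp [pullback]
    have ha (p q : MvPolynomial (Fin n) k) : pullback φ (p + q) = pullback φ p + pullback φ q := by
      simp [pullback]
    rw [hm, dirDeriv_mul, hp, hX, dirDeriv_mul, dirDeriv_X, ha, hm, hm, hC]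

theorem isHomogeneous_pullback {d : ℕ} (φ : (Fin m → k) →ₗ[k] (Fin n → k))
    {G : MvPolynomial (Fin n) k} (hG : G.IsHomogeneous d) : (pullback φ G).IsHomogeneous d := by
  have := hG.aeval (fun i : Fin n => ∑ j : Fin m, C (φ (Pi.single j 1) i) * X j) (n := 1)
    fun i => IsHomogeneous.sum _ _ _ fun j _ => isHomogeneous_C_mul_X _ _
  rwa [one_mul] at this

/-- The polarization of a quartic form `H` (without the factor `1 / 4!`): its fourth derivative
in four given directions, a constant when `H` is homogeneous of degree four. -/
def polar (H : MvPolynomial (Fin n) k) (a b c d : Fin n → k) : k :=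
  constantCoeff (dirDeriv a (dirDeriv b (dirDeriv c (dirDeriv d H))))

theorem polar_swap₁₂ (H : MvPolynomial (Fin n) k) (a b c d : Fin n → k) :
    polar H a b c d = polar H b a c d := by
  rw [polar, dirDeriv_comm, polar]

theorem polar_swap₂₃ (H : MvPolynomial (Fin n) k) (a b c d : Fin n → k) :
    polar H a b c d = polar H a c b d := by
  rw [polar, dirDeriv_comm b, polar]

theorem polar_swap₃₄ (H : MvPolynomial (Fin n) k) (a b c d : Fin n → k) :
    polar H a b c d = polar H a b d c := by
  rw [polar, dirDeriv_comm c, polar]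

theorem polar_self₃ {H : MvPolynomial (Fin n) k} (hH : H.IsHomogeneous 4) (v w : Fin n → k) :
    polar H v v v w = 6 * eval v (dirDeriv w H) := by
  have h3 : (dirDeriv w H).IsHomogeneous 3 := isHomogeneous_dirDeriv hH w
  have h2 : (dirDeriv v (dirDeriv w H)).IsHomogeneous 2 := isHomogeneous_dirDeriv h3 v
  have h1 : (dirDeriv v (dirDeriv v (dirDeriv w H))).IsHomogeneous 1 :=
    isHomogeneous_dirDeriv h2 v
  have h0 : (dirDeriv v (dirDeriv v (dirDeriv v (dirDeriv w H)))).IsHomogeneous 0 :=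
    isHomogeneous_dirDeriv h1 v
  have e3 := eval_dirDeriv_self h3 v
  have e2 := eval_dirDeriv_self h2 v
  have e1 := eval_dirDeriv_self h1 v
  have e0 : eval v (dirDeriv v (dirDeriv v (dirDeriv v (dirDeriv w H)))) = polar H v v v w := by
    rw [← totalDegree_zero_iff_isHomogeneous, totalDegree_eq_zero_iff_eq_C] at h0
    rw [polar, h0, eval_C, constantCoeff_C]
  rw [← e0, e1, e2, e3]
  push_cast
  ring

theorem polar_self {H : MvPolynomial (Fin n) k} (hH : H.IsHomogeneous 4) (v : Fin n → k) :
    polar H v v v v = 24 * eval v H := by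
  rw [polar_self₃ hH, eval_dirDeriv_self hH]
  push_cast
  ring

theorem polar_sub_smul (G F : MvPolynomial (Fin n) k) (t : k) (a b c d : Fin n → k) :
    polar (G - t • F) a b c d = polar G a b c d - t * polar F a b c d := by
  simp [polar, map_sub, map_smul]

/-- If the gradient of a quartic form vanishes at all points of a subspace, then its polarization
vanishes as soon as three of its arguments lie in a line `⟨p, q⟩` of that subspace. -/
theorem polar_eq_zero_of_gradient [CharZero k] {H : MvPolynomial (Fin n) k}
    (hH : H.IsHomogeneous 4) {L : Submodule k (Fin n → k)}
    (hL : ∀ v ∈ L, ∀ w, eval v (dirDeriv w H) = 0) {p q : Fin n → k} (hp : p ∈ L) (hq : q ∈ L)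
    (w : Fin n → k) : polar H p p q w = 0 := by
  have key : ∀ v ∈ L, polar H v v v w = 0 := fun v hv => by
    rw [polar_self₃ hH, hL v hv, mul_zero]
  have h1 := key _ (L.add_mem hp hq)
  have h2 := key _ (L.sub_mem hp hq)
  have h3 := key q hq
  have s1 : polar H p q p w = polar H p p q w := polar_swap₂₃ ..
  have s2 : polar H q p p w = polar H p p q w := by rw [polar_swap₁₂, s1]
  have s3 : polar H q p q w = polar H p q q w := polar_swap₁₂ ..
  have s4 : polar H q q p w = polar H p q q w := by rw [polar_swap₂₃, s3]
  simp only [polar, map_add, map_sub, LinearMap.add_apply, LinearMap.sub_apply] at *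
  have h6 : (6 : k) ≠ 0 := by norm_num
  refine (mul_eq_zero.mp (?_ : (6 : k) * _ = 0)).resolve_left h6
  linear_combination h1 - h2 - 2 * h3 - 2 * s1 - 2 * s2

end Polarization

/-! ### Quartic forms singular along the configuration -/

section Uniqueness

variable {k : Type*} [Field k] [CharZero k]

/-- In `Fin 5`, a sum over all indices is a sum over any five distinct ones. -/
theorem sum_eq_of_nodup {A : Type*} [AddCommMonoid A] {j l m a b : Fin 5}
    (h : [j, l, m, a, b].Nodup) (f : Fin 5 → A) : ∑ x, f x = f j + f l + f m + f a + f b := by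
  have hu : (Finset.univ : Finset (Fin 5)) = [j, l, m, a, b].toFinset :=
    (Finset.eq_univ_of_card _ (by rw [List.toFinset_card_of_nodup h]; rfl)).symm
  rw [hu, List.sum_toFinset _ h]
  simp [add_assoc]

/-- A symmetric tensor on `k⁵` with the contractions of the polarization of a quartic form which
is singular along the 15 lines (in the basis of the five points `0j`) is determined by its entry
at `0, 0, 1, 1`. Entries with three equal indices vanish, all other entries with two equal indices
agree; for the five entries with distinct indices the last condition says that each of them is a
sum of two others in every possible way. -/
theorem tensor_eq_zero (T : Fin 5 → Fin 5 → Fin 5 → Fin 5 → k)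
    (s₁₂ : ∀ a b c d, T a b c d = T b a c d) (s₂₃ : ∀ a b c d, T a b c d = T a c b d)
    (s₃₄ : ∀ a b c d, T a b c d = T a b d c)
    (h₃ : ∀ j w, T j j j w = 0)
    (h₂ : ∀ j l m w, [j, l, m].Nodup → T j j l w + T j j m w = 1 / 2 * ∑ x, T j j x w)
    (h₁ : ∀ j l m w, [j, l, m].Nodup →
      ∑ x, ∑ y, (if x = l ∨ x = m then (1 : k) else -1) * (if y = l ∨ y = m then 1 else -1) *
        T x y j w = 0)
    (h : T 0 0 1 1 = 0) (a b c d : Fin 5) : T a b c d = 0 := by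
  have eq₁ (j l m w) (hn : [j, l, m].Nodup) : T j j l w = T j j m w := by
    obtain ⟨n, hn'⟩ : ∃ n : Fin 5, [j, l, m, n].Nodup := by revert j l m; decide
    have e1 := h₂ j l n w (by simp_all)
    have e2 := h₂ j m n w (by simp_all)
    linear_combination e1 - e2
  have s₁₃₂₄ (l m) : T l l m m = T m m l l := by
    rw [s₂₃, s₁₂, s₃₄, s₂₃]
  -- all entries `T j j l l` agree
  have eq₂ (j l m) (hn : [j, l, m].Nodup) : T j j l l = T j j m m := by
    rw [eq₁ j l m l hn, s₃₄, eq₁ j l m m hn]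
  have pair₀ (m) : T 0 0 m m = 0 := by
    rcases eq_or_ne m 0 with rfl | h0
    · exact h₃ 0 0
    rcases eq_or_ne m 1 with rfl | h1
    · exact h
    · rw [eq₂ 0 m 1 (by simp [h1, h0.symm]), h]
  have pair (l m) : T l l m m = 0 := by
    rcases eq_or_ne l m with rfl | hlm
    · exact h₃ l l
    rcases eq_or_ne l 0 with rfl | h0
    · exact pair₀ m
    rcases eq_or_ne m 0 with rfl | h0'
    · rw [s₁₃₂₄, pair₀]
    · rw [eq₂ l m 0 (by simp [hlm, h0, h0']), s₁₃₂₄, pair₀]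
  have rep (j l m) : T j j l m = 0 := by
    rcases eq_or_ne j l with rfl | hjl
    · exact h₃ j m
    rcases eq_or_ne j m with rfl | hjm
    · rw [s₃₄, h₃]
    rcases eq_or_ne l m with rfl | hlm
    · exact pair j l
    · rw [eq₁ j l m m (by simp [hjl, hjm, hlm]), pair]
  have rep₁₃ (j l m) : T j l j m = 0 := by rw [s₂₃, rep]
  have rep₁₄ (j l m) : T j l m j = 0 := by rw [s₃₄, rep₁₃]
  have rep₂₃ (j l m) : T l j j m = 0 := by rw [s₁₂, rep₁₃]
  have rep₂₄ (j l m) : T l j m j = 0 := by rw [s₁₂, rep₁₄]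
  have rep₃₄ (j l m) : T l m j j = 0 := by rw [s₂₃, rep₂₄]
  have eq₃ (j l m a b) (hn : [j, l, m, a, b].Nodup) :
      T a b j l = T m a j l + T m b j l := by
    have e := h₁ j l m l (by simp_all)
    simp only [sum_eq_of_nodup hn] at e
    have h2 : (2 : k) ≠ 0 := two_ne_zero
    simp only [List.nodup_cons, List.mem_cons, List.not_mem_nil, or_false, not_or] at hn
    obtain ⟨⟨n1, n2, n3, n4⟩, ⟨n5, n6, n7⟩, ⟨n8, n9⟩, n10, -⟩ := hn
    simp [n1, n2, n5, Ne.symm n5, Ne.symm n6, Ne.symm n7,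
      Ne.symm n8, Ne.symm n9, rep, rep₁₃, rep₁₄, rep₂₃, rep₂₄] at e
    apply mul_left_cancel₀ h2
    linear_combination e + s₁₂ a b j l + s₁₂ a m j l + s₁₂ b m j l
  have distinct (j l m a b) (hn : [j, l, m, a, b].Nodup) : T a b j l = 0 := by
    have hp : [j, l, a, m, b].Nodup ∧ [j, l, b, m, a].Nodup := by
      clear * - hn
      grind
    have e1 := eq₃ j l a m b hp.1
    have e2 := eq₃ j l b m a hp.2
    have h2 : (2 : k) ≠ 0 := two_ne_zero
    refine (mul_eq_zero.mp (?_ : (2 : k) * _ = 0)).resolve_left h2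
    linear_combination -e1 - e2 + s₁₂ a b j l + s₁₂ m a j l - s₁₂ b m j l
  by_cases hn : [c, d, a, b].Nodup
  · obtain ⟨m, hm⟩ : ∃ m, [c, d, m, a, b].Nodup := by revert a b c d; decide
    exact distinct c d m a b hm
  · simp only [List.nodup_cons, List.mem_cons, List.not_mem_nil, or_false, not_or] at hn
    by_cases h1 : a = b
    · subst h1; apply rep
    by_cases h2 : a = c
    · subst h2; apply rep₁₃
    by_cases h3 : a = d
    · subst h3; apply rep₁₄
    by_cases h4 : b = c
    · subst h4; apply rep₂₃
    by_cases h5 : b = d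
    · subst h5; apply rep₂₄
    by_cases h6 : c = d
    · subst h6; apply rep₃₄
    exact absurd ⟨⟨h6, Ne.symm h2, Ne.symm h4⟩, ⟨Ne.symm h3, Ne.symm h5⟩, h1, not_false, by simp⟩ hn

end Uniqueness

section Vanishing

variable {k : Type*} [Field k] [CharZero k] {n : ℕ}

omit [CharZero k] in
theorem polar_sum_smul (H : MvPolynomial (Fin n) k) {ι : Type*} [Fintype ι] (ε : ι → k)
    (e : ι → Fin n → k) (c d : Fin n → k) :
    polar H (∑ x, ε x • e x) (∑ x, ε x • e x) c d =
      ∑ x, ∑ y, ε x * ε y * polar H (e x) (e y) c d := by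
  rw [Finset.sum_comm]
  simp [polar, map_sum, map_smul, LinearMap.sum_apply, LinearMap.smul_apply, Finset.mul_sum,
    mul_assoc, mul_left_comm]

/-- A quartic form which is singular along the lines joining `e j` to
`e l + e m - (1 / 2) ∑ x, e x` vanishes as soon as one coefficient of its polarization does. -/
theorem eq_zero_of_singular {H : MvPolynomial (Fin n) k} (hH : H.IsHomogeneous 4)
    (e : Fin 5 → Fin n → k) (hspan : ∀ v, ∃ c : Fin 5 → k, v = ∑ i, c i • e i)
    (hlines : ∀ j l m, [j, l, m].Nodup → ∃ L : Submodule k (Fin n → k),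
      e j ∈ L ∧ e l + e m - (1 / 2 : k) • ∑ x, e x ∈ L ∧
        ∀ v ∈ L, ∀ w, eval v (dirDeriv w H) = 0)
    (h : polar H (e 0) (e 0) (e 1) (e 1) = 0) : H = 0 := by
  have hT : ∀ a b c d, polar H (e a) (e b) (e c) (e d) = 0 := by
    refine tensor_eq_zero _ (fun _ _ _ _ => polar_swap₁₂ ..) (fun _ _ _ _ => polar_swap₂₃ ..)
      (fun _ _ _ _ => polar_swap₃₄ ..) ?_ ?_ ?_ h
    · intro j w
      obtain ⟨l, m, hn⟩ : ∃ l m : Fin 5, [j, l, m].Nodup := by revert j; decide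
      obtain ⟨L, hj, -, hL⟩ := hlines j l m hn
      exact polar_eq_zero_of_gradient hH hL hj hj _
    · intro j l m w hn
      obtain ⟨L, hj, hlm, hL⟩ := hlines j l m hn
      have := polar_eq_zero_of_gradient hH hL hj hlm (e w)
      simp only [polar, map_add, map_sub, map_smul, map_sum, LinearMap.add_apply,
        LinearMap.sub_apply, LinearMap.smul_apply, LinearMap.sum_apply] at this ⊢
      rw [constantCoeff_smul, smul_eq_mul, map_sum] at this
      linear_combination this
    · intro j l m w hn
      obtain ⟨L, hj, hlm, hL⟩ := hlines j l m hn
      have := polar_eq_zero_of_gradient hH hL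
        (L.smul_mem 2 hlm) hj (e w)
      have hs : (2 : k) • (e l + e m - (1 / 2 : k) • ∑ x, e x) =
          ∑ x, (if x = l ∨ x = m then (1 : k) else -1) • e x := by
        obtain ⟨a, b, hn'⟩ : ∃ a b : Fin 5, [j, l, m, a, b].Nodup := by
          clear * - hn
          revert j l m; decide
        rw [sum_eq_of_nodup hn', sum_eq_of_nodup hn']
        simp only [List.nodup_cons, List.mem_cons, List.not_mem_nil, or_false, not_or] at hn'
        obtain ⟨⟨n1, n2, n3, n4⟩, ⟨n5, n6, n7⟩, ⟨n8, n9⟩, n10, -⟩ := hn'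
        simp only [n1, n2, Ne.symm n6, Ne.symm n7, Ne.symm n8, Ne.symm n9, or_self, true_or,
          or_true, if_true, if_false]
        module
      rw [hs] at this
      rwa [polar_sum_smul] at this
  refine IsHomogeneous.eq_zero_of_forall_eval_eq_zero hH fun v => ?_
  obtain ⟨c, rfl⟩ := hspan v
  refine (mul_eq_zero.mp (?_ : (24 : k) * _ = 0)).resolve_left (by norm_num)
  rw [← polar_self hH]
  simp only [polar] at hT
  simp [polar, map_sum, map_smul, LinearMap.sum_apply, LinearMap.smul_apply, hT]

end Vanishing

/-! ### The standard configuration and the Igusa quartic -/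

section Standard

variable {k : Type*} [Field k]

/-- In `Fin 6`, a sum over all indices is a sum over any six distinct ones. -/
theorem sum_eq_of_nodup_six {A : Type*} [AddCommMonoid A] {a b c d e f : Fin 6}
    (h : [a, b, c, d, e, f].Nodup) (g : Fin 6 → A) :
    ∑ x, g x = g a + g b + g c + g d + g e + g f := by
  have hu : (Finset.univ : Finset (Fin 6)) = [a, b, c, d, e, f].toFinset :=
    (Finset.eq_univ_of_card _ (by rw [List.toFinset_card_of_nodup h]; rfl)).symm
  rw [hu, List.sum_toFinset _ h]
  simp [add_assoc]

theorem mem_sumZero {x : Fin 6 → k} : x ∈ sumZero k ↔ ∑ i, x i = 0 := Iff.rfl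

variable (k) in
/-- The representative `3 (εᵢ + εⱼ) - (1, …, 1)` of the intersection point of the standard
configuration labelled by the pair `{i, j}`. -/
def crPoint (i j : Fin 6) : sumZero k :=
  ⟨fun t => (if t = i then 3 else 0) + (if t = j then 3 else 0) - 1, by
    rw [mem_sumZero]
    simp [Finset.sum_add_distrib]
    norm_num⟩

theorem crPoint_apply (i j t : Fin 6) : (crPoint k i j : Fin 6 → k) t =
    (if t = i then 3 else 0) + (if t = j then 3 else 0) - 1 := rfl

theorem crPoint_comm (i j : Fin 6) : crPoint k i j = crPoint k j i := by
  ext t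
  rw [crPoint_apply, crPoint_apply, add_comm (if t = i then (3 : k) else 0)]

theorem mem_splittingLine {a b c d e f : Fin 6} {x : sumZero k} :
    x ∈ splittingLine k {a, b} {c, d} {e, f} ↔
      (x : Fin 6 → k) a = (x : Fin 6 → k) b ∧ (x : Fin 6 → k) c = (x : Fin 6 → k) d ∧
        (x : Fin 6 → k) e = (x : Fin 6 → k) f := by
  constructor
  · intro h
    exact ⟨h a b (by simp), h c d (by simp), h e f (by simp)⟩
  · rintro ⟨h1, h2, h3⟩ i j hij
    simp only [Finset.mem_insert, Finset.mem_singleton] at hij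
    rcases hij with ⟨rfl | rfl, rfl | rfl⟩ | ⟨rfl | rfl, rfl | rfl⟩ | ⟨rfl | rfl, rfl | rfl⟩ <;>
      simp [h1, h2, h3]

theorem splittingLine_mem_crLines {a b c d e f : Fin 6} (h : [a, b, c, d, e, f].Nodup) :
    splittingLine k {a, b} {c, d} {e, f} ∈ crLines k := by
  have hu : ({a, b} ∪ {c, d} ∪ {e, f} : Finset (Fin 6)) = Finset.univ := by
    refine Finset.eq_univ_of_card _ ?_
    rw [show ({a, b} ∪ {c, d} ∪ {e, f} : Finset (Fin 6)) = [a, b, c, d, e, f].toFinset by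
      ext x
      simp only [Finset.mem_union, Finset.mem_insert, Finset.mem_singleton, List.mem_toFinset,
        List.mem_cons, List.not_mem_nil, or_false, or_assoc], List.toFinset_card_of_nodup h]
    rfl
  simp only [List.nodup_cons, List.mem_cons, List.not_mem_nil, or_false, not_or] at h
  refine ⟨{a, b}, {c, d}, {e, f}, ?_, ?_, ?_, ?_, ?_, ?_, hu, rfl⟩ <;>
    simp [h, eq_comm]

theorem exists_eq_splittingLine {L : Submodule k (sumZero k)} (hL : L ∈ crLines k) :
    ∃ a b c d e f : Fin 6, [a, b, c, d, e, f].Nodup ∧ L = splittingLine k {a, b} {c, d} {e, f} := by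
  obtain ⟨I₁, I₂, I₃, h1, h2, h3, h12, h13, h23, -, rfl⟩ := hL
  obtain ⟨a, b, hab, rfl⟩ := Finset.card_eq_two.mp h1
  obtain ⟨c, d, hcd, rfl⟩ := Finset.card_eq_two.mp h2
  obtain ⟨e, f, hef, rfl⟩ := Finset.card_eq_two.mp h3
  refine ⟨a, b, c, d, e, f, ?_, rfl⟩
  simp only [Finset.disjoint_insert_left, Finset.disjoint_singleton_left, Finset.mem_insert,
    Finset.mem_singleton, not_or] at h12 h13 h23
  simp [*]

theorem crPoint_mem_left {a b c d e f : Fin 6} (h : [a, b, c, d, e, f].Nodup) :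
    crPoint k a b ∈ splittingLine k {a, b} {c, d} {e, f} := by
  simp only [List.nodup_cons, List.mem_cons, List.not_mem_nil, or_false, not_or] at h
  rw [mem_splittingLine]
  simp only [crPoint_apply]
  grind

theorem crPoint_mem_middle {a b c d e f : Fin 6} (h : [a, b, c, d, e, f].Nodup) :
    crPoint k c d ∈ splittingLine k {a, b} {c, d} {e, f} := by
  simp only [List.nodup_cons, List.mem_cons, List.not_mem_nil, or_false, not_or] at h
  rw [mem_splittingLine]
  simp only [crPoint_apply]
  grind

theorem crPoint_mem_right {a b c d e f : Fin 6} (h : [a, b, c, d, e, f].Nodup) :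
    crPoint k e f ∈ splittingLine k {a, b} {c, d} {e, f} := by
  simp only [List.nodup_cons, List.mem_cons, List.not_mem_nil, or_false, not_or] at h
  rw [mem_splittingLine]
  simp only [crPoint_apply]
  grind

variable [CharZero k]

theorem crPoint_notMem {a b c d e f : Fin 6} (h : [a, b, c, d, e, f].Nodup) :
    crPoint k c d ∉ splittingLine k {a, b} {c, e} {d, f} := by
  simp only [List.nodup_cons, List.mem_cons, List.not_mem_nil, or_false, not_or] at h
  rw [mem_splittingLine]
  simp only [crPoint_apply]
  have h3 : (3 : k) ≠ 0 := by norm_num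
  grind

theorem crPoint_ne_zero {i j : Fin 6} : crPoint k i j ≠ 0 := by
  obtain ⟨t, hi, hj⟩ : ∃ t : Fin 6, t ≠ i ∧ t ≠ j := by revert i j; decide
  intro h
  have := congrFun (congrArg Subtype.val h) t
  simp [crPoint_apply, hi, hj] at this

omit [CharZero k] in
theorem sum_crPoint_zero (t : Fin 6) :
    ((∑ x : Fin 5, crPoint k 0 x.succ : sumZero k) : Fin 6 → k) t = if t = 0 then 10 else -2 := by
  rw [AddSubmonoidClass.coe_finsetSum, Finset.sum_apply]
  simp only [crPoint_apply]
  fin_cases t <;> simp [Fin.sum_univ_five] <;> norm_num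

theorem crPoint_succ_succ {l m : Fin 5} :
    crPoint k l.succ m.succ = crPoint k 0 l.succ + crPoint k 0 m.succ -
      (1 / 2 : k) • ∑ x : Fin 5, crPoint k 0 x.succ := by
  ext t
  simp only [Submodule.coe_sub, Submodule.coe_add, Submodule.coe_smul, Pi.sub_apply, Pi.add_apply,
    Pi.smul_apply, sum_crPoint_zero, crPoint_apply, smul_eq_mul]
  rcases eq_or_ne t 0 with rfl | h
  · simp [(Fin.succ_ne_zero _).symm]
    norm_num
  · simp [h]
    ring

theorem eq_sum_crPoint (x : sumZero k) :
    x = ∑ j : Fin 5, (((x : Fin 6 → k) j.succ + (x : Fin 6 → k) 0 / 2) / 3) •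
      crPoint k 0 j.succ := by
  have hx := mem_sumZero.mp x.2
  ext t
  rw [AddSubmonoidClass.coe_finsetSum, Finset.sum_apply]
  simp only [Submodule.coe_smul, Pi.smul_apply, crPoint_apply, smul_eq_mul]
  rw [Fin.sum_univ_six] at hx
  fin_cases t <;> simp [Fin.sum_univ_five]
  · linear_combination (-2 / 3 : k) * hx
  all_goals linear_combination (1 / 3 : k) * hx

theorem finrank_sumZero : Module.finrank k (sumZero k) = 5 := by
  have h : sumZero k = LinearMap.ker (∑ i, LinearMap.proj i : Module.Dual k (Fin 6 → k)) := by
    ext x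
    simp [mem_sumZero, LinearMap.sum_apply]
  have h0 : (∑ i, LinearMap.proj i : Module.Dual k (Fin 6 → k)) ≠ 0 := fun h => by
    have := LinearMap.congr_fun h (Pi.single 0 1)
    simp [LinearMap.sum_apply] at this
  have := Module.Dual.finrank_ker_add_one_of_ne_zero h0
  rw [← h] at this
  simpa using this

omit [CharZero k] in
theorem isHomogeneous_igusaForm : (igusaForm k).IsHomogeneous 4 := by
  refine IsHomogeneous.sub (IsHomogeneous.sum _ _ _ fun i _ => isHomogeneous_X_pow i 4) ?_
  refine IsHomogeneous.C_mul ?_ _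
  exact (IsHomogeneous.sum _ _ 2 fun i _ => isHomogeneous_X_pow i 2).pow 2

theorem eval_dirDeriv_igusaForm (v w : Fin 6 → k) : eval v (dirDeriv w (igusaForm k)) =
    4 * ∑ i, v i ^ 3 * w i - (∑ i, v i ^ 2) * ∑ i, v i * w i := by
  have h2 (i : Fin 6) : dirDeriv w (X i ^ 2 : MvPolynomial (Fin 6) k) = 2 * X i * C (w i) := by
    rw [sq, dirDeriv_mul, dirDeriv_X]; ring
  have h4 (i : Fin 6) :
      dirDeriv w (X i ^ 4 : MvPolynomial (Fin 6) k) = 4 * X i ^ 3 * C (w i) := by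
    rw [show (X i ^ 4 : MvPolynomial (Fin 6) k) = X i ^ 2 * X i ^ 2 by ring, dirDeriv_mul, h2]; ring
  rw [igusaForm, map_sub, dirDeriv_mul, dirDeriv_C, sq (∑ i, _), dirDeriv_mul, map_sum, map_sum]
  simp only [h2, h4, map_sub, map_sum, map_mul, map_add, eval_X, eval_C, map_pow, map_ofNat,
    mul_assoc, ← Finset.mul_sum, map_zero]
  ring

/-- With `v = (a, a, b, b, c, c)` and `a + b + c = 0`, each of `a`, `b`, `c` is a root of a cubic
`t³ - ½ (a² + b² + c²) t - abc`, so the gradient of the Igusa form at `v` is proportional to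
`(1, …, 1)`. -/
theorem eval_dirDeriv_igusaForm_eq_zero {L : Submodule k (sumZero k)} (hL : L ∈ crLines k)
    {v : sumZero k} (hv : v ∈ L) (w : sumZero k) :
    eval (v : Fin 6 → k) (dirDeriv (w : Fin 6 → k) (igusaForm k)) = 0 := by
  obtain ⟨a, b, c, d, e, f, hn, rfl⟩ := exists_eq_splittingLine hL
  obtain ⟨hab, hcd, hef⟩ := mem_splittingLine.mp hv
  have hv0 := mem_sumZero.mp v.2
  have hw0 := mem_sumZero.mp w.2
  rw [eval_dirDeriv_igusaForm]
  simp only [sum_eq_of_nodup_six hn, hab, hcd, hef] at hv0 hw0 ⊢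
  have hf : (v : Fin 6 → k) f = -(v : Fin 6 → k) b - (v : Fin 6 → k) d := by
    linear_combination hv0 / 2
  rw [hf]
  linear_combination 4 * (v : Fin 6 → k) b * (v : Fin 6 → k) d *
    (-(v : Fin 6 → k) b - (v : Fin 6 → k) d) * hw0

theorem exists_eval_igusaForm_ne_zero :
    ∃ x : sumZero k, eval (x : Fin 6 → k) (igusaForm k) ≠ 0 := by
  refine ⟨⟨![1, -1, 0, 0, 0, 0], by simp [mem_sumZero, Fin.sum_univ_six]⟩, ?_⟩
  simp [igusaForm, Fin.sum_univ_six]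
  norm_num

end Standard

/-! ### Rigidity of the configuration -/

section Rigidity

variable {k V : Type*} [Field k] [AddCommGroup V] [Module k V]

variable (k) in
/-- Three vectors satisfy a linear relation with nonzero coefficients. For vectors representing
points of a projective space, pairwise distinct in the cases of interest, this says that the
points are collinear. -/
def Collinear₃ (x y z : V) : Prop :=
  ∃ α β γ : k, α ≠ 0 ∧ β ≠ 0 ∧ γ ≠ 0 ∧ α • x + β • y + γ • z = 0

theorem Collinear₃.rotate {x y z : V} (h : Collinear₃ k x y z) : Collinear₃ k y z x := by
  obtain ⟨α, β, γ, hα, hβ, hγ, h⟩ := h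
  exact ⟨β, γ, α, hβ, hγ, hα, by rw [← h]; abel⟩

/-- The relation of three collinear points can be scaled to have a given first coefficient. -/
theorem Collinear₃.exists_of_coeff {x y z : V} (h : Collinear₃ k x y z) {c : k} (hc : c ≠ 0) :
    ∃ β γ : k, β ≠ 0 ∧ γ ≠ 0 ∧ c • x + β • y + γ • z = 0 := by
  obtain ⟨α, β, γ, hα, hβ, hγ, h⟩ := h
  refine ⟨c / α * β, c / α * γ, by positivity, by positivity, ?_⟩
  have h' := congrArg (fun t => (c / α) • t) h
  simp only [smul_add, smul_smul, smul_zero, div_mul_cancel₀ c hα] at h'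
  exact h'

theorem Collinear₃.mem {x y z : V} (h : Collinear₃ k x y z) {W : Submodule k V} (hx : x ∈ W)
    (hy : y ∈ W) : z ∈ W := by
  obtain ⟨α, β, γ, -, -, hγ, h⟩ := h
  have : γ • z ∈ W := by
    rw [eq_neg_of_add_eq_zero_right h]
    exact W.neg_mem (W.add_mem (W.smul_mem _ hx) (W.smul_mem _ hy))
  exact (W.smul_mem_iff hγ).mp this

theorem Collinear₃.smul_left {x y z : V} (h : Collinear₃ k x y z) {c : k} (hc : c ≠ 0) :
    Collinear₃ k (c • x) y z := by
  obtain ⟨β, γ, hβ, hγ, h⟩ := h.exists_of_coeff hc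
  exact ⟨1, β, γ, one_ne_zero, hβ, hγ, by rw [one_smul, h]⟩

/-- In a `3 × 3` grid of points spanning a `ℙ³`, with collinear rows and columns, representatives
can be scaled so that all rows and all columns sum to zero. The relation of each line is scaled to
agree with the previous ones at one point; the independence of four of the points then forces
agreement at all points. -/
theorem exists_grid_scaling (g : Fin 3 → Fin 3 → V)
    (ind : ∀ α β γ δ : k, α • g 0 0 + β • g 0 1 + γ • g 1 0 + δ • g 1 1 = 0 →
      α = 0 ∧ β = 0 ∧ γ = 0 ∧ δ = 0)
    (hrow : ∀ i, Collinear₃ k (g i 0) (g i 1) (g i 2))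
    (hcol : ∀ j, Collinear₃ k (g 0 j) (g 1 j) (g 2 j)) :
    ∃ c : Fin 3 → Fin 3 → k, (∀ i j, c i j ≠ 0) ∧
      (∀ i, c i 0 • g i 0 + c i 1 • g i 1 + c i 2 • g i 2 = 0) ∧
      ∀ j, c 0 j • g 0 j + c 1 j • g 1 j + c 2 j • g 2 j = 0 := by
  obtain ⟨c00, c01, c02, h00, h01, h02, hr0⟩ := hrow 0
  obtain ⟨c10, c20, h10, h20, hk0⟩ := (hcol 0).exists_of_coeff h00
  obtain ⟨c11, c21, h11, h21, hk1⟩ := (hcol 1).exists_of_coeff h01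
  obtain ⟨c12, c22, h12, h22, hk2⟩ := (hcol 2).exists_of_coeff h02
  obtain ⟨d11, d12, i11, i12, hr1⟩ := (hrow 1).exists_of_coeff h10
  obtain ⟨d21, d22, i21, i22, hr2⟩ := (hrow 2).exists_of_coeff h20
  -- `ρ`, `τ`, `ω` compare the scalings that two lines through the same point prescribe there
  obtain ⟨ρ, rfl⟩ : ∃ ρ, d21 = ρ * c21 := ⟨d21 / c21, (div_mul_cancel₀ _ h21).symm⟩
  obtain ⟨τ, rfl⟩ : ∃ τ, c12 = τ * d12 := ⟨c12 / d12, (div_mul_cancel₀ _ i12).symm⟩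
  obtain ⟨ω, rfl⟩ : ∃ ω, c22 = ω * d22 := ⟨c22 / d22, (div_mul_cancel₀ _ i22).symm⟩
  have key : (ω * c00 - c00) • g 0 0 + (ω * ρ * c01 - c01) • g 0 1 +
      (ω * c10 - τ * c10) • g 1 0 + (ω * ρ * c11 - τ * d11) • g 1 1 = 0 := by
    linear_combination (norm := module) hk2 - hr0 - τ • hr1 - ω • hr2 + ω • hk0 + (ω * ρ) • hk1
  obtain ⟨e1, e2, e3, e4⟩ := ind _ _ _ _ key
  have hω : ω = 1 := mul_right_cancel₀ h00 (by linear_combination e1)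
  subst hω
  have hτ : τ = 1 := mul_right_cancel₀ h10 (by linear_combination -e3)
  subst hτ
  have hρ : ρ = 1 := mul_right_cancel₀ h01 (by linear_combination e2)
  subst hρ
  have hd : d11 = c11 := by linear_combination -e4
  subst hd
  simp only [one_mul] at *
  refine ⟨![![c00, c01, c02], ![c10, d11, d12], ![c20, c21, d22]], ?_, ?_, ?_⟩
  · intro i j
    fin_cases i <;> fin_cases j <;> assumption
  · intro i
    fin_cases i <;> assumption
  · intro j
    fin_cases j <;> assumption

/-- Given a scaled grid `h` (all of whose `2 × 2` minors `h i j - h i 0 - h 0 j + h 0 0` vanish) and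
points `A i`, `B j` outside of its span with `A i`, `B j`, `h i j` collinear, the `A i` and `B j`
can be scaled so that `A i + B j + h i j = 0`. -/
theorem exists_bipartite_scaling (h : Fin 3 → Fin 3 → V) (A B : Fin 3 → V)
    (hminor : ∀ i j, h i j = h i 0 + h 0 j - h 0 0)
    (hcoll : ∀ i j, Collinear₃ k (h i j) (A i) (B j))
    (ind : ∀ i j, i ≠ 0 → j ≠ 0 → ∀ α β γ δ : k,
      α • A 0 + β • h 0 0 + γ • h i 0 + δ • h 0 j = 0 → α = 0 ∧ β = 0 ∧ γ = 0 ∧ δ = 0) :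
    ∃ a b : Fin 3 → k, (∀ i, a i ≠ 0) ∧ (∀ j, b j ≠ 0) ∧
      ∀ i j, a i • A i + b j • B j + h i j = 0 := by
  obtain ⟨a₀, b₀, ha₀, hb₀, h₀⟩ := (hcoll 0 0).exists_of_coeff one_ne_zero
  have hA (i) : ∃ a x : k, a ≠ 0 ∧ a • A i + b₀ • B 0 + x • h i 0 = 0 ∧
      (i = 0 → a = a₀ ∧ x = 1) := by
    rcases eq_or_ne i 0 with rfl | hi
    · exact ⟨a₀, 1, ha₀, by rw [← h₀]; abel, fun _ => ⟨rfl, rfl⟩⟩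
    · obtain ⟨x, a, -, ha, e⟩ := (hcoll i 0).rotate.rotate.exists_of_coeff hb₀
      exact ⟨a, x, ha, by rw [← e]; abel, fun h => absurd h hi⟩
  have hB (j) : ∃ b z : k, b ≠ 0 ∧ a₀ • A 0 + b • B j + z • h 0 j = 0 ∧
      (j = 0 → b = b₀ ∧ z = 1) := by
    rcases eq_or_ne j 0 with rfl | hj
    · exact ⟨b₀, 1, hb₀, by rw [← h₀]; abel, fun _ => ⟨rfl, rfl⟩⟩
    · obtain ⟨b, z, hb, -, e⟩ := (hcoll 0 j).rotate.exists_of_coeff ha₀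
      exact ⟨b, z, hb, e, fun h => absurd h hj⟩
  choose a x ha hax hx using hA
  choose b z hb hbz hz using hB
  have square (i j) (hi : i ≠ 0) (hj : j ≠ 0) :
      x i = 1 ∧ z j = 1 ∧ a i • A i + b j • B j + h i j = 0 := by
    obtain ⟨b', p, hb', -, e⟩ := (hcoll i j).rotate.exists_of_coeff (ha i)
    obtain ⟨τ, rfl⟩ : ∃ τ, b' = τ * b j := ⟨b' / b j, (div_mul_cancel₀ _ (hb j)).symm⟩
    have key : (a₀ - τ * a₀) • A 0 + (1 - p) • h 0 0 + (p - x i) • h i 0 +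
        (p - τ * z j) • h 0 j = 0 := by
      rw [hminor] at e
      linear_combination (norm := module) e - hax i - τ • hbz j + h₀
    obtain ⟨e1, e2, e3, e4⟩ := ind i j hi hj _ _ _ _ key
    have hτ : τ = 1 := mul_right_cancel₀ ha₀ (by linear_combination -e1)
    have hp : p = 1 := by linear_combination -e2
    subst hτ hp
    refine ⟨by linear_combination -e3, by linear_combination -e4, ?_⟩
    rw [← e, one_mul, one_smul]
  have hx1 (i) : x i = 1 := by
    rcases eq_or_ne i 0 with rfl | hi
    · exact (hx 0 rfl).2
    · exact (square i 1 hi one_ne_zero).1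
  have hz1 (j) : z j = 1 := by
    rcases eq_or_ne j 0 with rfl | hj
    · exact (hz 0 rfl).2
    · exact (square 1 j one_ne_zero hj).2.1
  refine ⟨a, b, ha, hb, fun i j => ?_⟩
  rcases eq_or_ne i 0 with rfl | hi
  · rw [(hx 0 rfl).1, ← hbz j, hz1, one_smul]
  rcases eq_or_ne j 0 with rfl | hj
  · rw [(hz 0 rfl).1, ← hax i, hx1, one_smul]
  exact (square i j hi hj).2.2

variable [CharZero k]

/-- The linear map from the hyperplane `∑ xᵢ = 0` sending the points `0j` of the standard
configuration to given vectors. -/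
theorem exists_linearMap_crPoint (u : Fin 5 → V) :
    ∃ ψ : sumZero k →ₗ[k] V, ∀ j, ψ (crPoint k 0 j.succ) = u j := by
  refine ⟨Fintype.linearCombination k u ∘ₗ LinearMap.pi fun j : Fin 5 =>
    (1 / 3 : k) • ((LinearMap.proj j.succ + (1 / 2 : k) • LinearMap.proj 0) ∘ₗ
      (sumZero k).subtype), fun j => ?_⟩
  have h : ∀ l : Fin 5, (1 / 3 : k) * ((crPoint k 0 j.succ : Fin 6 → k) l.succ +
      1 / 2 * (crPoint k 0 j.succ : Fin 6 → k) 0) = if l = j then 1 else 0 := fun l => by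
    simp only [crPoint_apply, Fin.succ_ne_zero, (Fin.succ_ne_zero _).symm, Fin.succ_inj, if_true,
      if_false]
    split_ifs <;> norm_num
  simp only [LinearMap.comp_apply, Fintype.linearCombination_apply, LinearMap.pi_apply,
    LinearMap.smul_apply, LinearMap.add_apply, LinearMap.proj_apply, Submodule.subtype_apply,
    smul_eq_mul, h]
  simp

/-- Fifteen points of `ℙ⁴`, labelled by the pairs in `{0, …, 5}` so that the three pairs of each
splitting label collinear points, and not contained in a hyperplane, are projectively equivalent
to the points of the standard configuration. -/
theorem exists_linearEquiv (v : Fin 6 → Fin 6 → V) (hsymm : ∀ i j, v i j = v j i)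
    (hcoll : ∀ a b c d e f : Fin 6, [a, b, c, d, e, f].Nodup →
      Collinear₃ k (v a b) (v c d) (v e f))
    (hspan : ∀ W : Submodule k V, (∀ i j, i ≠ j → v i j ∈ W) → W = ⊤)
    (hrank : Module.finrank k V = 5) :
    ∃ ψ : sumZero k ≃ₗ[k] V, ∀ i j, i ≠ j → ∃ c : k, c ≠ 0 ∧ ψ (crPoint k i j) = c • v i j := by
  have hlt (W : Submodule k V) (hW : ∀ i j, i < j → v i j ∈ W) : W = ⊤ := by
    refine hspan W fun i j hij => ?_
    rcases lt_or_gt_of_ne hij with h | h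
    · exact hW i j h
    · rw [hsymm]; exact hW j i h
  -- four points of a grid and one point outside of it generate the configuration
  have hind : LinearIndependent k ![v 0 3, v 1 4, v 1 5, v 2 3, v 1 2] := by
    refine linearIndependent_of_top_le_span_of_card_eq_finrank ?_ (by simp [hrank])
    set W := Submodule.span k (Set.range ![v 0 3, v 1 4, v 1 5, v 2 3, v 1 2])
    have hW (i : Fin 5) : ![v 0 3, v 1 4, v 1 5, v 2 3, v 1 2] i ∈ W :=
      Submodule.subset_span ⟨i, rfl⟩
    have m03 : v 0 3 ∈ W := hW 0
    have m14 : v 1 4 ∈ W := hW 1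
    have m15 : v 1 5 ∈ W := hW 2
    have m23 : v 2 3 ∈ W := hW 3
    have m12 : v 1 2 ∈ W := hW 4
    have m25 : v 2 5 ∈ W := (hcoll 0 3 1 4 2 5 (by decide)).mem m03 m14
    have m24 : v 2 4 ∈ W := (hcoll 0 3 1 5 2 4 (by decide)).mem m03 m15
    have m04 : v 0 4 ∈ W := (hcoll 1 5 2 3 0 4 (by decide)).mem m15 m23
    have m05 : v 0 5 ∈ W := (hcoll 1 4 2 3 0 5 (by decide)).mem m14 m23
    have m13 : v 1 3 ∈ W := (hcoll 2 4 0 5 1 3 (by decide)).mem m24 m05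
    have m45 : v 4 5 ∈ W := (hcoll 1 2 0 3 4 5 (by decide)).mem m12 m03
    have m35 : v 3 5 ∈ W := (hcoll 1 2 0 4 3 5 (by decide)).mem m12 m04
    have m34 : v 3 4 ∈ W := (hcoll 1 2 0 5 3 4 (by decide)).mem m12 m05
    have m02 : v 0 2 ∈ W := (hcoll 4 5 1 3 0 2 (by decide)).mem m45 m13
    have m01 : v 0 1 ∈ W := (hcoll 4 5 2 3 0 1 (by decide)).mem m45 m23
    refine (hlt W fun i j hij => ?_).ge
    fin_cases i <;> fin_cases j
    all_goals first | exact absurd hij (by decide) | skip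
    all_goals assumption
  have ind : ∀ α β γ δ ε : k,
      α • v 0 3 + β • v 1 4 + γ • v 1 5 + δ • v 2 3 + ε • v 1 2 = 0 →
        α = 0 ∧ β = 0 ∧ γ = 0 ∧ δ = 0 ∧ ε = 0 := by
    intro α β γ δ ε h
    have := Fintype.linearIndependent_iff.mp hind ![α, β, γ, δ, ε]
      (by simpa [Fin.sum_univ_five] using h)
    exact ⟨this 0, this 1, this 2, this 3, this 4⟩
  obtain ⟨c, hc, hr, hk⟩ := exists_grid_scaling
    ![![v 0 3, v 1 4, v 2 5], ![v 1 5, v 2 3, v 0 4], ![v 2 4, v 0 5, v 1 3]]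
    (fun α β γ δ h => by
      obtain ⟨h1, h2, h3, h4, -⟩ := ind α β γ δ 0 (by rw [zero_smul, add_zero]; exact h)
      exact ⟨h1, h2, h3, h4⟩)
    (fun i => by fin_cases i <;> exact hcoll _ _ _ _ _ _ (by decide))
    (fun i => by fin_cases i <;> exact hcoll _ _ _ _ _ _ (by decide))
  have hr0 : c 0 0 • v 0 3 + c 0 1 • v 1 4 + c 0 2 • v 2 5 = 0 := hr 0
  have hr1 : c 1 0 • v 1 5 + c 1 1 • v 2 3 + c 1 2 • v 0 4 = 0 := hr 1
  have hr2 : c 2 0 • v 2 4 + c 2 1 • v 0 5 + c 2 2 • v 1 3 = 0 := hr 2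
  have hk0 : c 0 0 • v 0 3 + c 1 0 • v 1 5 + c 2 0 • v 2 4 = 0 := hk 0
  have hk1 : c 0 1 • v 1 4 + c 1 1 • v 2 3 + c 2 1 • v 0 5 = 0 := hk 1
  have hk2 : c 0 2 • v 2 5 + c 1 2 • v 0 4 + c 2 2 • v 1 3 = 0 := hk 2
  obtain ⟨a, b, ha, hb, hs⟩ := exists_bipartite_scaling (k := k)
    ![![c 0 0 • v 0 3, c 1 2 • v 0 4, c 2 1 • v 0 5],
      ![c 2 2 • v 1 3, c 0 1 • v 1 4, c 1 0 • v 1 5],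
      ![c 1 1 • v 2 3, c 2 0 • v 2 4, c 0 2 • v 2 5]]
    ![v 1 2, v 0 2, v 0 1] ![v 4 5, v 3 5, v 3 4]
    (fun i j => by
      fin_cases i <;> fin_cases j <;>
        simp only [Matrix.cons_val, Fin.reduceFinMk, Fin.zero_eta, Fin.isValue, add_sub_cancel_left,
          add_sub_cancel_right]
      · linear_combination (norm := module) hr0 - hk2
      · linear_combination (norm := module) hk0 - hr2
      · linear_combination (norm := module) hk0 - hr1
      · linear_combination (norm := module) hr0 - hk1)
    (fun i j => by
      fin_cases i <;> fin_cases j <;>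
        exact (hcoll _ _ _ _ _ _ (by decide)).smul_left (hc _ _))
    (fun i j hi hj α β γ δ h => by
      fin_cases i <;> fin_cases j
      all_goals first | exact absurd rfl hi | exact absurd rfl hj | skip
      · replace h : α • v 1 2 + β • c 0 0 • v 0 3 + γ • c 2 2 • v 1 3 + δ • c 1 2 • v 0 4 = 0 := h
        have := ind ((β + γ) * c 0 0) (γ * c 0 1) ((γ - δ) * c 1 0) ((γ - δ) * c 1 1) α
          (by linear_combination (norm := module) h - γ • (hr2 - hk0 - hk1) - δ • hr1)
        simp only [mul_eq_zero, hc, or_false, sub_eq_zero] at this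
        grind
      · replace h : α • v 1 2 + β • c 0 0 • v 0 3 + γ • c 2 2 • v 1 3 + δ • c 2 1 • v 0 5 = 0 := h
        have := ind ((β + γ) * c 0 0) ((γ - δ) * c 0 1) (γ * c 1 0) ((γ - δ) * c 1 1) α
          (by linear_combination (norm := module) h - γ • (hr2 - hk0 - hk1) - δ • hk1)
        simp only [mul_eq_zero, hc, or_false, sub_eq_zero] at this
        grind
      · replace h : α • v 1 2 + β • c 0 0 • v 0 3 + γ • c 1 1 • v 2 3 + δ • c 1 2 • v 0 4 = 0 := h
        have := ind (β * c 0 0) (0) (-δ * c 1 0) ((γ - δ) * c 1 1) α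
          (by linear_combination (norm := module) h - δ • hr1)
        simp only [mul_eq_zero, hc, or_false, sub_eq_zero] at this
        grind
      · replace h : α • v 1 2 + β • c 0 0 • v 0 3 + γ • c 1 1 • v 2 3 + δ • c 2 1 • v 0 5 = 0 := h
        have := ind (β * c 0 0) (-δ * c 0 1) (0) ((γ - δ) * c 1 1) α
          (by linear_combination (norm := module) h - δ • hk1)
        simp only [mul_eq_zero, hc, or_false, sub_eq_zero] at this
        grind)
  have hs00 : a 0 • v 1 2 + b 0 • v 4 5 + c 0 0 • v 0 3 = 0 := hs 0 0
  have hs01 : a 0 • v 1 2 + b 1 • v 3 5 + c 1 2 • v 0 4 = 0 := hs 0 1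
  have hs02 : a 0 • v 1 2 + b 2 • v 3 4 + c 2 1 • v 0 5 = 0 := hs 0 2
  have hs10 : a 1 • v 0 2 + b 0 • v 4 5 + c 2 2 • v 1 3 = 0 := hs 1 0
  have hs11 : a 1 • v 0 2 + b 1 • v 3 5 + c 0 1 • v 1 4 = 0 := hs 1 1
  have hs12 : a 1 • v 0 2 + b 2 • v 3 4 + c 1 0 • v 1 5 = 0 := hs 1 2
  have hs20 : a 2 • v 0 1 + b 0 • v 4 5 + c 1 1 • v 2 3 = 0 := hs 2 0
  have hs21 : a 2 • v 0 1 + b 1 • v 3 5 + c 2 0 • v 2 4 = 0 := hs 2 1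
  have hs22 : a 2 • v 0 1 + b 2 • v 3 4 + c 0 2 • v 2 5 = 0 := hs 2 2
  set u : Fin 5 → V :=
    ![a 2 • v 0 1, a 1 • v 0 2, c 0 0 • v 0 3, c 1 2 • v 0 4, c 2 1 • v 0 5] with hu
  obtain ⟨ψ, hψ⟩ := exists_linearMap_crPoint (k := k) u
  have h₀ (l : Fin 5) : ∃ t : k, t ≠ 0 ∧ ψ (crPoint k 0 l.succ) = t • v 0 l.succ := by
    rw [hψ]
    fin_cases l
    exacts [⟨a 2, ha _, rfl⟩, ⟨a 1, ha _, rfl⟩, ⟨c 0 0, hc _ _, rfl⟩, ⟨c 1 2, hc _ _, rfl⟩,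
      ⟨c 2 1, hc _ _, rfl⟩]
  have h₁ (l m : Fin 5) (hlm : l < m) :
      ∃ t : k, t ≠ 0 ∧ ψ (crPoint k l.succ m.succ) = t • v l.succ m.succ := by
    rw [crPoint_succ_succ, map_sub, map_add, map_smul, map_sum]
    simp only [hψ]
    fin_cases l <;> fin_cases m
    all_goals first | exact absurd hlm (by decide) | skip
    -- For `{l, m, x, y, z} = {1, …, 5}`, the relations of the lines through
    -- `{lm, yz, 0x}`, `{lm, xz, 0y}` and `{lx, my, 0z}`, minus those through `{lx, yz, 0m}` and
    -- `{my, xz, 0l}`, add up to `2 (lm) + 0x + 0y + 0z - 0l - 0m = 0`.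
    · refine ⟨a 0, ha _, ?_⟩
      simp only [hu, Fin.sum_univ_five, Matrix.cons_val, Fin.reduceFinMk]
      change _ = (a 0) • v 1 2
      linear_combination (norm := module) (-1 / 2 : k) • (hs00 + hs01 - hs10 - hs21 + hr2)
    · refine ⟨c 2 2, hc _ _, ?_⟩
      simp only [hu, Fin.sum_univ_five, Matrix.cons_val, Fin.reduceFinMk]
      change _ = (c 2 2) • v 1 3
      linear_combination (norm := module) (-1 / 2 : k) • (hs10 + hk2 - hs00 - hs22 + hs02)
    · refine ⟨c 0 1, hc _ _, ?_⟩
      simp only [hu, Fin.sum_univ_five, Matrix.cons_val, Fin.reduceFinMk]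
      change _ = (c 0 1) • v 1 4
      linear_combination (norm := module) (-1 / 2 : k) • (hs11 + hr0 - hs01 - hs22 + hs02)
    · refine ⟨c 1 0, hc _ _, ?_⟩
      simp only [hu, Fin.sum_univ_five, Matrix.cons_val, Fin.reduceFinMk]
      change _ = (c 1 0) • v 1 5
      linear_combination (norm := module) (-1 / 2 : k) • (hs12 + hk0 - hs02 - hs21 + hs01)
    · refine ⟨c 1 1, hc _ _, ?_⟩
      simp only [hu, Fin.sum_univ_five, Matrix.cons_val, Fin.reduceFinMk]
      change _ = (c 1 1) • v 2 3
      linear_combination (norm := module) (-1 / 2 : k) • (hs20 + hr1 - hs00 - hs12 + hs02)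
    · refine ⟨c 2 0, hc _ _, ?_⟩
      simp only [hu, Fin.sum_univ_five, Matrix.cons_val, Fin.reduceFinMk]
      change _ = (c 2 0) • v 2 4
      linear_combination (norm := module) (-1 / 2 : k) • (hs21 + hk0 - hs01 - hs12 + hs02)
    · refine ⟨c 0 2, hc _ _, ?_⟩
      simp only [hu, Fin.sum_univ_five, Matrix.cons_val, Fin.reduceFinMk]
      change _ = (c 0 2) • v 2 5
      linear_combination (norm := module) (-1 / 2 : k) • (hs22 + hr0 - hs02 - hs11 + hs01)
    · refine ⟨b 2, hb _, ?_⟩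
      simp only [hu, Fin.sum_univ_five, Matrix.cons_val, Fin.reduceFinMk]
      change _ = (b 2) • v 3 4
      linear_combination (norm := module) (-1 / 2 : k) • (hs22 + hs12 - hk2 - hk0 + hr2)
    · refine ⟨b 1, hb _, ?_⟩
      simp only [hu, Fin.sum_univ_five, Matrix.cons_val, Fin.reduceFinMk]
      change _ = (b 1) • v 3 5
      linear_combination (norm := module) (-1 / 2 : k) • (hs21 + hs11 - hr2 - hr0 + hk2)
    · refine ⟨b 0, hb _, ?_⟩
      simp only [hu, Fin.sum_univ_five, Matrix.cons_val, Fin.reduceFinMk]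
      change _ = (b 0) • v 4 5
      linear_combination (norm := module) (-1 / 2 : k) • (hs20 + hs10 - hk1 - hk2 + hr0)
  have h₂ (i j : Fin 6) (hij : i < j) : ∃ t : k, t ≠ 0 ∧ ψ (crPoint k i j) = t • v i j := by
    obtain ⟨m, rfl⟩ := Fin.exists_succ_eq.mpr (Fin.ne_zero_of_lt hij)
    rcases eq_or_ne i 0 with rfl | hi
    · exact h₀ m
    · obtain ⟨l, rfl⟩ := Fin.exists_succ_eq.mpr hi
      exact h₁ l m (Fin.succ_lt_succ_iff.mp hij)
  have hsurj : Function.Surjective ψ := by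
    rw [← LinearMap.range_eq_top]
    refine hlt _ fun i j hij => ?_
    obtain ⟨t, ht, e⟩ := h₂ i j hij
    rw [← Submodule.smul_mem_iff _ ht, ← e]
    exact LinearMap.mem_range_self ψ _
  have : FiniteDimensional k V := Module.finite_of_finrank_pos (by omega)
  have hinj : Function.Injective ψ :=
    (LinearMap.injective_iff_surjective_of_finrank_eq_finrank
      (by rw [finrank_sumZero, hrank])).mpr hsurj
  refine ⟨LinearEquiv.ofBijective ψ ⟨hinj, hsurj⟩, fun i j hij => ?_⟩
  rcases lt_or_gt_of_ne hij with h | h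
  · exact h₂ i j h
  · rw [crPoint_comm, hsymm]
    exact h₂ j i h

end Rigidity

/-! ### Labelling the points of a configuration -/

section Labelling

theorem nodup_six_iff {a b c d e f : Fin 6} : [a, b, c, d, e, f].Nodup ↔
    (a ≠ b ∧ a ≠ c ∧ a ≠ d ∧ a ≠ e ∧ a ≠ f) ∧ (b ≠ c ∧ b ≠ d ∧ b ≠ e ∧ b ≠ f) ∧
      (c ≠ d ∧ c ≠ e ∧ c ≠ f) ∧ (d ≠ e ∧ d ≠ f) ∧ e ≠ f := by
  simp

theorem nodup_swap_inner {a b c d e f : Fin 6} (h : [a, b, c, d, e, f].Nodup) :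
    [a, b, c, e, d, f].Nodup := by
  rw [nodup_six_iff] at h ⊢
  simp_all [eq_comm]

theorem nodup_swap_pairs {a b c d e f : Fin 6} (h : [a, b, c, d, e, f].Nodup) :
    [a, b, e, f, c, d].Nodup := by
  rw [nodup_six_iff] at h ⊢
  simp_all [eq_comm]

theorem nodup_rotate_pairs {a b c d e f : Fin 6} (h : [a, b, c, d, e, f].Nodup) :
    [c, d, e, f, a, b].Nodup :=
  List.nodup_rotate (n := 2).mpr h

variable {k : Type*} [Field k] {V : Type*} [AddCommGroup V] [Module k V]

theorem eq_span_pair {L : Submodule k V} (hL : Module.finrank k L = 2) {x y : V} (hx : x ∈ L)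
    (hy : y ∈ L) (hxy : LinearIndependent k ![x, y]) : L = Submodule.span k {x, y} := by
  have : FiniteDimensional k L := Module.finite_of_finrank_pos (by omega)
  refine (Submodule.eq_of_le_of_finrank_eq ?_ ?_).symm
  · rw [Submodule.span_le]
    rintro _ (rfl | rfl) <;> assumption
  · have := finrank_span_eq_card hxy
    rw [Matrix.range_cons_cons_empty] at this
    rw [this, hL, Fintype.card_fin]

theorem collinear₃_of_mem {L : Submodule k V} (hL : Module.finrank k L = 2) {x y z : V}
    (hx : x ∈ L) (hy : y ∈ L) (hz : z ∈ L) (hxy : LinearIndependent k ![x, y])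
    (hxz : LinearIndependent k ![x, z]) (hyz : LinearIndependent k ![y, z]) :
    Collinear₃ k x y z := by
  rw [eq_span_pair hL hx hy hxy, Submodule.mem_span_pair] at hz
  obtain ⟨a, b, rfl⟩ := hz
  refine ⟨a, b, -1, ?_, ?_, by simp, by module⟩
  · rintro rfl
    have := LinearIndependent.pair_iff.mp hyz b (-1) (by module)
    simp at this
  · rintro rfl
    have := LinearIndependent.pair_iff.mp hxz a (-1) (by module)
    simp at this

theorem mem_pointSet_iff {p : ℙ k V} {L : Submodule k V} : p ∈ pointSet L ↔ p.rep ∈ L := by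
  rw [pointSet, Set.mem_ofPred_eq, Projectivization.submodule_eq,
    Submodule.span_singleton_le_iff_mem]

theorem mk_mem_pointSet_iff {v : V} (hv : v ≠ 0) {L : Submodule k V} :
    Projectivization.mk k v hv ∈ pointSet L ↔ v ∈ L := by
  rw [pointSet, Set.mem_ofPred_eq, Projectivization.submodule_mk,
    Submodule.span_singleton_le_iff_mem]

variable [CharZero k]

theorem mk_crPoint_mem_intersectionPoints {i j : Fin 6} (hij : i ≠ j) :
    Projectivization.mk k (crPoint k i j) crPoint_ne_zero ∈ intersectionPoints (crLines k) := by
  obtain ⟨c, d, e, f, hn⟩ : ∃ c d e f, [i, j, c, d, e, f].Nodup := by revert i j; decide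
  have hn' : [i, j, c, e, d, f].Nodup := nodup_swap_inner hn
  refine ⟨_, splittingLine_mem_crLines hn, _, splittingLine_mem_crLines hn', fun h => ?_,
    (mk_mem_pointSet_iff _).mpr (crPoint_mem_left hn),
    (mk_mem_pointSet_iff _).mpr (crPoint_mem_left hn')⟩
  exact crPoint_notMem (k := k) hn (h ▸ crPoint_mem_middle hn)

/-- A combinatorial isomorphism to the standard configuration provides representatives of the
intersection points labelled by pairs of indices, incident to the lines as the standard points. -/
theorem exists_labelling {S : Set (Submodule k V)} (hcr : CombIso S (crLines k)) :
    ∃ (f : S ≃ crLines k) (v : Fin 6 → Fin 6 → V), (∀ i j, v i j = v j i) ∧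
      ∀ i j, i ≠ j → v i j ≠ 0 ∧ ∀ L : S,
        v i j ∈ (L : Submodule k V) ↔ crPoint k i j ∈ (f L : Submodule k (sumZero k)) := by
  obtain ⟨f, g, h⟩ := hcr
  -- for `i = j` there is no point and the vector is arbitrary
  have key (i j : Fin 6) : ∃ x : V, i ≠ j → x ≠ 0 ∧ ∀ L : S,
      x ∈ (L : Submodule k V) ↔ crPoint k i j ∈ (f L : Submodule k (sumZero k)) := by
    by_cases hij : i = j
    · exact ⟨0, fun h => absurd hij h⟩
    · refine ⟨(g.symm ⟨_, mk_crPoint_mem_intersectionPoints hij⟩ : ℙ k V).rep, fun _ =>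
        ⟨Projectivization.rep_nonzero _, fun L => ?_⟩⟩
      rw [← mem_pointSet_iff, h, Equiv.apply_symm_apply, mk_mem_pointSet_iff]
  choose x hx using key
  -- the representatives of the points `ij` and `ji` have to be the same vector
  refine ⟨f, fun i j => x (min i j) (max i j), fun i j => by simp only [min_comm i j, max_comm i j],
    fun i j hij => ?_⟩
  rcases le_total i j with h' | h'
  · simpa only [min_eq_left h', max_eq_right h'] using hx i j hij
  · simpa only [min_eq_right h', max_eq_left h', crPoint_comm i j] using hx j i hij.symm

end Labelling

/-! ### Conclusion -/

section Conclusion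

variable {k : Type*} [Field k] [CharZero k]

theorem eval_dirDeriv_eq_zero_of_singular {F : MvPolynomial (Fin 5) k} (hF : F.IsHomogeneous 4)
    {L : Submodule k (Fin 5 → k)} (hL : pointSet L ⊆ singularLocus F) {v : Fin 5 → k} (hv : v ∈ L)
    (w : Fin 5 → k) : eval v (dirDeriv w F) = 0 := by
  rcases eq_or_ne v 0 with rfl | h0
  · refine (mul_eq_zero.mp (?_ : (6 : k) * _ = 0)).resolve_left (by norm_num)
    rw [← polar_self₃ hF]
    simp [polar]
  · have := hL ((mk_mem_pointSet_iff h0).mpr hv) v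
      (by rw [Projectivization.submodule_mk]; exact Submodule.mem_span_singleton_self v)
    simp [dirDeriv_apply, smul_eval, this.2]

/-- A configuration as in the theorem is the image of the standard one under a linear
isomorphism. -/
theorem exists_linearEquiv_configuration {S : Set (Submodule k (Fin 5 → k))}
    (hS : ∀ L ∈ S, Module.finrank k L = 2)
    (hnd : ¬ ∃ H : Submodule k (Fin 5 → k), Module.finrank k H = 4 ∧ ∀ L ∈ S, L ≤ H)
    (hcr : CombIso S (crLines k)) :
    ∃ ψ : sumZero k ≃ₗ[k] (Fin 5 → k),
      (∀ L ∈ S, ∃ M ∈ crLines k, L ≤ M.map ψ.toLinearMap) ∧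
      ∀ a b c d e f : Fin 6, [a, b, c, d, e, f].Nodup →
        ∃ L ∈ S, ψ (crPoint k a b) ∈ L ∧ ψ (crPoint k c d) ∈ L := by
  obtain ⟨f, v, hsymm, hv⟩ := exists_labelling hcr
  have hne {i j a b c d : Fin 6} (hn : [i, j, a, b, c, d].Nodup) : i ≠ j ∧ a ≠ b ∧ c ≠ d := by
    rw [nodup_six_iff] at hn
    exact ⟨hn.1.1, hn.2.2.1.1, hn.2.2.2.2⟩
  have hind (a b c d e i : Fin 6) (hn : [a, b, c, d, e, i].Nodup) :
      LinearIndependent k ![v a b, v c d] := by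
    obtain ⟨hab, hcd, -⟩ := hne hn
    rw [LinearIndependent.pair_iff' (hv a b hab).1]
    intro t ht
    have ht0 : t ≠ 0 := by
      rintro rfl
      exact (hv c d hcd).1 (by rw [← ht, zero_smul])
    have hn' : [a, b, c, e, d, i].Nodup := nodup_swap_inner hn
    -- a line through the point `ab` but not through `cd`
    let L := f.symm ⟨_, splittingLine_mem_crLines hn'⟩
    have hL : (f L : Submodule k (sumZero k)) = splittingLine k {a, b} {c, e} {d, i} := by simp [L]
    have h1 : v a b ∈ (L : Submodule k (Fin 5 → k)) := by
      rw [(hv a b hab).2, hL]; exact crPoint_mem_left hn'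
    have h2 : v c d ∈ (L : Submodule k (Fin 5 → k)) := by
      rw [← ht]; exact Submodule.smul_mem _ _ h1
    rw [(hv c d hcd).2, hL] at h2
    exact crPoint_notMem hn h2
  have hline (a b c d e i : Fin 6) (hn : [a, b, c, d, e, i].Nodup) (L : S)
      (hL : (f L : Submodule k (sumZero k)) = splittingLine k {a, b} {c, d} {e, i}) :
      v a b ∈ (L : Submodule k (Fin 5 → k)) ∧ v c d ∈ (L : Submodule k (Fin 5 → k)) ∧
        v e i ∈ (L : Submodule k (Fin 5 → k)) := by
    obtain ⟨hab, hcd, hei⟩ := hne hn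
    rw [(hv a b hab).2, (hv c d hcd).2, (hv e i hei).2, hL]
    exact ⟨crPoint_mem_left hn, crPoint_mem_middle hn, crPoint_mem_right hn⟩
  have hline' (a b c d e i : Fin 6) (hn : [a, b, c, d, e, i].Nodup) :
      ∃ L ∈ S, v a b ∈ L ∧ v c d ∈ L ∧ v e i ∈ L :=
    ⟨_, (f.symm ⟨_, splittingLine_mem_crLines hn⟩).2, hline a b c d e i hn _ (by simp)⟩
  have hspan : ∀ L ∈ S, ∃ a b c d e i : Fin 6, [a, b, c, d, e, i].Nodup ∧
      L = Submodule.span k {v a b, v c d} := by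
    intro L hL
    obtain ⟨a, b, c, d, e, i, hn, h⟩ := exists_eq_splittingLine (f ⟨L, hL⟩).2
    obtain ⟨h1, h2, -⟩ := hline a b c d e i hn _ h
    exact ⟨a, b, c, d, e, i, hn, eq_span_pair (hS L hL) h1 h2 (hind _ _ _ _ _ _ hn)⟩
  obtain ⟨ψ, hψ⟩ := exists_linearEquiv (k := k) v hsymm
    (fun a b c d e i hn => by
      obtain ⟨L, hL, h1, h2, h3⟩ := hline' a b c d e i hn
      exact collinear₃_of_mem (hS L hL) h1 h2 h3 (hind a b c d e i hn)
        (hind a b e i c d (nodup_swap_pairs hn)) (hind c d e i a b (nodup_rotate_pairs hn)))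
    (fun W hW => by
      by_contra hW'
      obtain ⟨φ, hφ, hle⟩ := W.exists_le_ker_of_lt_top (lt_top_iff_ne_top.mpr hW')
      refine hnd ⟨LinearMap.ker φ, ?_, fun L hL => le_trans ?_ hle⟩
      · have := Module.Dual.finrank_ker_add_one_of_ne_zero hφ
        simpa using this
      · obtain ⟨a, b, c, d, e, i, hn, rfl⟩ := hspan L hL
        rw [Submodule.span_le]
        rintro _ (rfl | rfl)
        · exact hW _ _ (hne hn).1
        · exact hW _ _ (hne hn).2.1)
    (by simp)
  refine ⟨ψ, fun L hL => ?_, fun a b c d e i hn => ?_⟩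
  · obtain ⟨a, b, c, d, e, i, hn, hLs⟩ := hspan L hL
    refine ⟨_, splittingLine_mem_crLines hn, ?_⟩
    rw [hLs, Submodule.span_le]
    have hmem {x y : Fin 6} (hxy : x ≠ y)
        (hm : crPoint k x y ∈ splittingLine k {a, b} {c, d} {e, i}) :
        v x y ∈ (splittingLine k {a, b} {c, d} {e, i}).map ψ.toLinearMap := by
      obtain ⟨t, ht, h⟩ := hψ x y hxy
      rw [← Submodule.smul_mem_iff _ ht, ← h]
      exact Submodule.mem_map_of_mem hm
    rintro _ (rfl | rfl)
    · exact hmem (hne hn).1 (crPoint_mem_left hn)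
    · exact hmem (hne hn).2.1 (crPoint_mem_middle hn)
  · obtain ⟨L, hL, h1, h2, -⟩ := hline' a b c d e i hn
    obtain ⟨s, -, hs⟩ := hψ a b (hne hn).1
    obtain ⟨t, -, ht⟩ := hψ c d (hne hn).2.1
    exact ⟨L, hL, hs ▸ L.smul_mem s h1, ht ▸ L.smul_mem t h2⟩

end Conclusion

end CremonaRichmond

end

open CremonaRichmond in
theorem corollaryA7 {k : Type*} [Field k] [IsAlgClosed k] [CharZero k]
    (S : Set (Submodule k (Fin 5 → k)))
    (hS : CremonaRichmond.IsConfiguration S)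
    (hnd : ¬ ∃ H : Submodule k (Fin 5 → k), Module.finrank k H = 4 ∧ ∀ L ∈ S, L ≤ H)
    (hcr : CremonaRichmond.CombIso S (CremonaRichmond.crLines k))
    (F : MvPolynomial (Fin 5) k) (hF0 : F ≠ 0) (hF : F.IsHomogeneous 4)
    (hsing : ∀ L ∈ S, CremonaRichmond.pointSet L ⊆ CremonaRichmond.singularLocus F) :
    CremonaRichmond.ProjIsoIgusa F := by
  obtain ⟨ψ, hψmap, hψ⟩ := exists_linearEquiv_configuration hS.isLine hnd hcr
  set G := pullback ((sumZero k).subtype ∘ₗ ψ.symm.toLinearMap) (igusaForm k) with hG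
  have hG4 : G.IsHomogeneous 4 := isHomogeneous_pullback _ isHomogeneous_igusaForm
  have hFgrad : ∀ L ∈ S, ∀ v ∈ L, ∀ w, eval v (dirDeriv w F) = 0 := fun L hL v hv w =>
    eval_dirDeriv_eq_zero_of_singular hF (hsing L hL) hv w
  have hGgrad : ∀ L ∈ S, ∀ v ∈ L, ∀ w, eval v (dirDeriv w G) = 0 := by
    intro L hL v hv w
    obtain ⟨M, hM, hLM⟩ := hψmap L hL
    obtain ⟨x, hx, rfl⟩ := hLM hv
    rw [hG, dirDeriv_pullback, eval_pullback]
    simpa using eval_dirDeriv_igusaForm_eq_zero hM hx (ψ.symm w)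
  have hG0 : G ≠ 0 := by
    obtain ⟨x, hx⟩ := exists_eval_igusaForm_ne_zero (k := k)
    intro h
    have := congrArg (eval (ψ x)) h
    rw [hG, eval_pullback] at this
    exact hx (by simpa using this)
  set e : Fin 5 → Fin 5 → k := fun j => ψ (crPoint k 0 j.succ) with he
  have hvanish (H : MvPolynomial (Fin 5) k) (hH : H.IsHomogeneous 4)
      (hgrad : ∀ L ∈ S, ∀ v ∈ L, ∀ w, eval v (dirDeriv w H) = 0)
      (h : polar H (e 0) (e 0) (e 1) (e 1) = 0) : H = 0 := by
    refine eq_zero_of_singular hH e (fun v => ?_) (fun j l m hn => ?_) h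
    · have := congrArg ψ (eq_sum_crPoint (ψ.symm v))
      rw [ψ.apply_symm_apply, map_sum] at this
      simp only [map_smul] at this
      exact ⟨_, this⟩
    · obtain ⟨a, b, hn'⟩ : ∃ a b : Fin 5, [j, l, m, a, b].Nodup := by
        clear * - hn
        revert j l m; decide
      have hn6 : [0, j.succ, l.succ, m.succ, a.succ, b.succ].Nodup := by
        have := (hn'.map (Fin.succ_injective 5))
        refine List.nodup_cons.mpr ⟨?_, this⟩
        simp [(Fin.succ_ne_zero _).symm]
      obtain ⟨L, hL, h1, h2⟩ := hψ _ _ _ _ _ _ hn6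
      refine ⟨L, h1, ?_, hgrad L hL⟩
      rw [crPoint_succ_succ, map_sub, map_add, map_smul, map_sum] at h2
      exact h2
  have hpF : polar F (e 0) (e 0) (e 1) (e 1) ≠ 0 := fun h => hF0 (hvanish F hF hFgrad h)
  -- the combination of `G` and `F` with vanishing entry of the polarization
  obtain ⟨t, ht⟩ : ∃ t, polar G (e 0) (e 0) (e 1) (e 1) = t * polar F (e 0) (e 0) (e 1) (e 1) :=
    ⟨_, (div_mul_cancel₀ _ hpF).symm⟩
  have hGF : G - t • F = 0 := by
    refine hvanish _ (hG4.sub ?_) (fun L hL v hv w => ?_) ?_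
    · rw [smul_eq_C_mul]
      exact hF.C_mul t
    · rw [map_sub, map_smul, map_sub, hGgrad L hL v hv, smul_eval, hFgrad L hL v hv, mul_zero,
        sub_zero]
    · rw [polar_sub_smul, ht, sub_self]
  rw [sub_eq_zero, smul_eq_C_mul] at hGF
  refine ⟨ψ.symm, t, ?_, hGF⟩
  rintro rfl
  exact hG0 (by rw [hGF, C_0, zero_mul])
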